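/- Let $M$ be a transitive class and let $j\colon V\to M$ be an elementary embedding of $(V,\in)$ into $(M,\in)$. For a set $A\in M$, the $M$-cardinality $|A|^M$ is the least ordinal $\alpha$ for which some bijection from $A$ onto $\alpha$ belongs to $M$. For a cardinal $\rho$, let $t_j(\rho)$ denote the least $M$-cardinality of a set $A\in M$ with $j[\rho]=\{j(\alpha):\alpha<\rho\}\subseteq A$. For an ordinal $\theta$ that is a cardinal in $M$, let $(2^\theta)^M=|P(\theta)\cap M|^M$ denote the value of $2^\theta$ as computed in $M$. Lemma. For every cardinal $\rho$, $t_j(\rho)$ is defined, and if $\theta=t_j(\rho)$, then $(2^\theta)^M$ is defined and $(2^\theta)^M\ge 2^\rho$, where cardinals of $V$ and of $M$ are identified with ordinals. -/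

import Mathlib

universe u

namespace SetTheoryModel

open FirstOrder

/-- The only symbol of the language of set theory: a binary relation symbol for membership. -/
inductive MemRel : ℕ → Type
  | mem : MemRel 2

/-- The first-order language of set theory. -/
def setLang : FirstOrder.Language.{0, 0} := ⟨fun _ => Empty, MemRel⟩

/-- The universe of sets `V`, as a structure in the language of set theory. -/
instance structureV : setLang.Structure ZFSet.{u} where
  funMap f := nomatch f
  RelMap | MemRel.mem, v => v 0 ∈ v 1

/-- A class `M` of sets with the true membership relation, as a structure in the language of
set theory. -/
instance structureClass (M : Set ZFSet.{u}) : setLang.Structure M where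
  funMap f := nomatch f
  RelMap | MemRel.mem, v => (v 0 : ZFSet.{u}) ∈ (v 1 : ZFSet.{u})

/-- A class is transitive if it contains every element of each of its elements. -/
def IsTransitiveClass (M : Set ZFSet.{u}) : Prop :=
  ∀ x ∈ M, ∀ y ∈ x, y ∈ M

/-- The set `f` is (the graph of) a bijection from the set `x` onto the set `y`. -/
def IsBijection (f x y : ZFSet.{u}) : Prop :=
  ZFSet.IsFunc x y f ∧ ∀ b ∈ y, ∃! a, ZFSet.pair a b ∈ f

/-- `|A|^M = α`: the set `A` belongs to `M`, and `α` is the least ordinal for which some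
bijection from `A` onto `α` belongs to `M`. Being an ordinal and being a bijection between two
given sets are absolute for transitive models, so for these this is the `M`-cardinality. -/
def IsCardIn (M : Set ZFSet.{u}) (A : ZFSet.{u}) (α : Ordinal.{u}) : Prop :=
  A ∈ M ∧ IsLeast {β : Ordinal.{u} | ∃ f ∈ M, IsBijection f A β.toZFSet} α

/-- `P^M(A)`: the set of all subsets of `A` that belong to `M`. -/
def powersetIn (M : Set ZFSet.{u}) (A : ZFSet.{u}) : ZFSet.{u} :=
  ZFSet.sep (fun x => x ∈ M) (ZFSet.powerset A)

/-- `(2^θ)^M = τ`: the power set of `θ` in the sense of `M` has `M`-cardinality `τ`. -/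
def IsTwoPowIn (M : Set ZFSet.{u}) (θ τ : Ordinal.{u}) : Prop :=
  IsCardIn M (powersetIn M θ.toZFSet) τ

/-- `t_j(ρ) = θ`: the least `M`-cardinality of a set in `M` that covers
`j[ρ] = {j(α) : α < ρ}` is `θ`. -/
def IsTightness {M : Set ZFSet.{u}} (j : ZFSet.{u} ↪ₑ[setLang] M) (ρ : Cardinal.{u})
    (θ : Ordinal.{u}) : Prop :=
  IsLeast {α : Ordinal.{u} | ∃ A : ZFSet.{u},
    (∀ x ∈ ρ.ord.toZFSet, (j x : ZFSet.{u}) ∈ A) ∧ IsCardIn M A α} θ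

end SetTheoryModel

open FirstOrder SetTheoryModel

namespace SetTheoryModel

open FirstOrder FirstOrder.Language

/-! ### Formulas of the language of set theory -/

/-! Let `A ∈ M` cover `j[ρ]` and let `f ∈ M` be a bijection from `A` onto `θ`. Send `X ⊆ ρ` to `f[A
∩ j(X)]`, a subset of `θ` lying in `M`. For `α < ρ` we have `j(α) ∈ A`, and `j(α) ∈ j(X)` iff `α ∈
X`; as `f` is injective, the image determines `X`. So `P(ρ)` injects into `P(θ) ∩ M`
(`two_power_le_card_powersetIn`), and a bijection in `M` from the latter onto `τ` gives `2^ρ ≤ |τ|`.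
All that `M` must satisfy is three sentences: every set is in bijection with an ordinal, power sets
exist, and images of intersections exist. Each holds in `V`, transfers along `j`, and is decoded in
`M` by absoluteness. -/

/-- The formula `xᵢ ∈ xₖ`. -/
def memFormula {n : ℕ} (i k : Fin n) : setLang.BoundedFormula Empty n :=
  Relations.boundedFormula₂ (L := setLang) MemRel.mem (Term.var (Sum.inr i)) (Term.var (Sum.inr k))

/-- The formula `xᵢ = xₖ`. -/
def eqFormula {n : ℕ} (i k : Fin n) : setLang.BoundedFormula Empty n :=
  Term.bdEqual (Term.var (Sum.inr i)) (Term.var (Sum.inr k))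

/-- The formula `xᵢ = {xₐ, x_b}`. -/
def unorderedPairFormula {n : ℕ} (i a b : Fin n) : setLang.BoundedFormula Empty n :=
  ((memFormula (Fin.last n) i.castSucc).iff
    (eqFormula (Fin.last n) a.castSucc ⊔ eqFormula (Fin.last n) b.castSucc)).all

/-- The formula `xᵢ = (xₐ, x_b)`, for Kuratowski pairs. -/
def pairFormula {n : ℕ} (i a b : Fin n) : setLang.BoundedFormula Empty n :=
  (memFormula (Fin.last n) i.castSucc ⊓
      unorderedPairFormula (Fin.last n) a.castSucc a.castSucc).ex ⊓
    ((memFormula (Fin.last n) i.castSucc ⊓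
      unorderedPairFormula (Fin.last n) a.castSucc b.castSucc).ex ⊓
    ((memFormula (Fin.last n) i.castSucc).imp
      (unorderedPairFormula (Fin.last n) a.castSucc a.castSucc ⊔
        unorderedPairFormula (Fin.last n) a.castSucc b.castSucc)).all)

/-- The formula `(xₐ, x_b) ∈ xᵢ`. -/
def pairMemFormula {n : ℕ} (a b i : Fin n) : setLang.BoundedFormula Empty n :=
  (memFormula (Fin.last n) i.castSucc ⊓ pairFormula (Fin.last n) a.castSucc b.castSucc).ex

/-- The formula `xᵢ ⊆ xₖ`. -/
def subsetFormula {n : ℕ} (i k : Fin n) : setLang.BoundedFormula Empty n :=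
  ((memFormula (Fin.last n) i.castSucc).imp (memFormula (Fin.last n) k.castSucc)).all

/-- The formula saying that `xᵢ` is a transitive set. -/
def transitiveFormula {n : ℕ} (i : Fin n) : setLang.BoundedFormula Empty n :=
  ((memFormula (Fin.last n) i.castSucc).imp (subsetFormula (Fin.last n) i.castSucc)).all

/-- The formula saying that `xᵢ` is an ordinal. -/
def ordinalFormula {n : ℕ} (i : Fin n) : setLang.BoundedFormula Empty n :=
  transitiveFormula i ⊓
    ((memFormula (Fin.last n) i.castSucc).imp (transitiveFormula (Fin.last n))).all

/-- The formula saying that every element of `x_f` is a pair in `xₐ × x_b`. -/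
def subsetProdFormula {n : ℕ} (f a b : Fin n) : setLang.BoundedFormula Empty n :=
  ((memFormula (Fin.last n) f.castSucc).imp
    (memFormula (Fin.last (n + 1)) a.castSucc.castSucc ⊓
      (memFormula (Fin.last (n + 2)) b.castSucc.castSucc.castSucc ⊓
        pairFormula (Fin.last n).castSucc.castSucc (Fin.last (n + 1)).castSucc
          (Fin.last (n + 2))).ex).ex).all

/-- The formula saying that for each `z ∈ xₐ` there is a unique `w` with `(z, w) ∈ x_f`. -/
def uniqueRightFormula {n : ℕ} (f a : Fin n) : setLang.BoundedFormula Empty n :=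
  ((memFormula (Fin.last n) a.castSucc).imp
    (pairMemFormula (Fin.last n).castSucc (Fin.last (n + 1)) f.castSucc.castSucc ⊓
      ((pairMemFormula (Fin.last n).castSucc.castSucc (Fin.last (n + 2))
        f.castSucc.castSucc.castSucc).imp
          (eqFormula (Fin.last (n + 2)) (Fin.last (n + 1)).castSucc)).all).ex).all

/-- The formula saying that for each `w ∈ x_b` there is a unique `z` with `(z, w) ∈ x_f`. -/
def uniqueLeftFormula {n : ℕ} (f b : Fin n) : setLang.BoundedFormula Empty n :=
  ((memFormula (Fin.last n) b.castSucc).imp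
    (pairMemFormula (Fin.last (n + 1)) (Fin.last n).castSucc f.castSucc.castSucc ⊓
      ((pairMemFormula (Fin.last (n + 2)) (Fin.last n).castSucc.castSucc
        f.castSucc.castSucc.castSucc).imp
          (eqFormula (Fin.last (n + 2)) (Fin.last (n + 1)).castSucc)).all).ex).all

/-- The formula saying that `x_f` is a bijection from `xₐ` onto `x_b`. -/
def bijectionFormula {n : ℕ} (f a b : Fin n) : setLang.BoundedFormula Empty n :=
  (subsetProdFormula f a b ⊓ uniqueRightFormula f a) ⊓ uniqueLeftFormula f b

/-- Every set is in bijection with an ordinal. -/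
def numerationSentence : setLang.Sentence :=
  (BoundedFormula.ex (BoundedFormula.ex (n := 2)
    (ordinalFormula (2 : Fin 3) ⊓ bijectionFormula (1 : Fin 3) 0 2))).all

/-- Every set has a power set. -/
def powersetSentence : setLang.Sentence :=
  (BoundedFormula.ex (BoundedFormula.all (n := 2)
    ((memFormula (2 : Fin 3) 1).iff (subsetFormula 2 0)))).all

/-- For all sets `f`, `x`, `y` the image of `x ∩ y` under the relation `f` is a set. -/
def imageInterSentence : setLang.Sentence :=
  (BoundedFormula.all (BoundedFormula.all (n := 2) (BoundedFormula.ex (n := 3)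
    (BoundedFormula.all (n := 4) ((memFormula (4 : Fin 5) 3).iff
      (BoundedFormula.ex (n := 5) (memFormula (5 : Fin 6) 1 ⊓
        (memFormula 5 2 ⊓ pairMemFormula 5 4 0)))))))).all

/-! ### Absoluteness for transitive models -/

/-- The map `ι` identifies the structure `S` with a transitive class with the true membership
relation. -/
structure IsTransitiveModel {S : Type*} [setLang.Structure S] (ι : S → ZFSet.{u}) : Prop where
  injective : Function.Injective ι
  relMap_iff : ∀ x y : S, Structure.RelMap (L := setLang) MemRel.mem ![x, y] ↔ ι x ∈ ι y
  exists_of_mem : ∀ (x : S), ∀ y ∈ ι x, ∃ z, ι z = y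

theorem isTransitiveModel_id : IsTransitiveModel (id : ZFSet.{u} → ZFSet.{u}) where
  injective := Function.injective_id
  relMap_iff _ _ := Iff.rfl
  exists_of_mem _ y _ := ⟨y, rfl⟩

theorem IsTransitiveClass.isTransitiveModel {M : Set ZFSet.{u}} (hM : IsTransitiveClass M) :
    IsTransitiveModel (Subtype.val : M → ZFSet.{u}) where
  injective := Subtype.val_injective
  relMap_iff _ _ := Iff.rfl
  exists_of_mem x y hy := ⟨⟨y, hM x x.2 y hy⟩, rfl⟩

namespace IsTransitiveModel

variable {S : Type*} [setLang.Structure S] {ι : S → ZFSet.{u}} {n : ℕ} {v : Empty → S}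
  {xs : Fin n → S}

/-- Only the elements of `y` must come from the model, so no closure under pairing is needed when
`y` is an unordered pair. -/
theorem ext_iff (h : IsTransitiveModel ι) (x : S) (y : ZFSet.{u}) (hy : ∀ z ∈ y, ∃ w, ι w = z) :
    ι x = y ↔ ∀ z : S, ι z ∈ ι x ↔ ι z ∈ y := by
  refine ⟨fun e z => by rw [e], fun H => ZFSet.ext fun z => ⟨fun hz => ?_, fun hz => ?_⟩⟩
  · obtain ⟨w, rfl⟩ := h.exists_of_mem x z hz
    exact (H w).1 hz
  · obtain ⟨w, rfl⟩ := hy z hz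
    exact (H w).2 hz

theorem forall_mem_iff (h : IsTransitiveModel ι) (x : S) (P : ZFSet.{u} → Prop) :
    (∀ z : S, ι z ∈ ι x → P (ι z)) ↔ ∀ z ∈ ι x, P z := by
  refine ⟨fun H z hz => ?_, fun H z hz => H _ hz⟩
  obtain ⟨w, rfl⟩ := h.exists_of_mem x z hz
  exact H w hz

theorem exists_mem_iff (h : IsTransitiveModel ι) (x : S) (P : ZFSet.{u} → Prop) :
    (∃ z : S, ι z ∈ ι x ∧ P (ι z)) ↔ ∃ z ∈ ι x, P z := by
  refine ⟨fun ⟨z, hz, hP⟩ => ⟨_, hz, hP⟩, fun ⟨z, hz, hP⟩ => ?_⟩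
  obtain ⟨w, rfl⟩ := h.exists_of_mem x z hz
  exact ⟨w, hz, hP⟩

/-- Transitivity is applied along `a, b ∈ {a, b} ∈ (a, b) ∈ f`. This makes unbounded quantifiers
over coordinates of pairs in `f` absolute. -/
theorem exists_of_pair_mem (h : IsTransitiveModel ι) {f : S} {a b : ZFSet.{u}}
    (hab : ZFSet.pair a b ∈ ι f) : (∃ z, ι z = a) ∧ ∃ z, ι z = b := by
  obtain ⟨p, hp⟩ := h.exists_of_mem f _ hab
  obtain ⟨q, hq⟩ := h.exists_of_mem p {a, b} (by simp [hp, ZFSet.pair])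
  exact ⟨h.exists_of_mem q a (by simp [hq]), h.exists_of_mem q b (by simp [hq])⟩

theorem realize_mem (h : IsTransitiveModel ι) (i k : Fin n) :
    (memFormula i k).Realize v xs ↔ ι (xs i) ∈ ι (xs k) := by
  refine Iff.trans ?_ (h.relMap_iff (xs i) (xs k))
  exact BoundedFormula.realize_rel₂

theorem realize_eq (i k : Fin n) : (eqFormula i k).Realize v xs ↔ xs i = xs k :=
  Iff.rfl

theorem realize_unorderedPair (h : IsTransitiveModel ι) (i a b : Fin n) :
    (unorderedPairFormula i a b).Realize v xs ↔ ι (xs i) = {ι (xs a), ι (xs b)} := by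
  rw [h.ext_iff _ _ (by rintro z hz; rcases ZFSet.mem_pair.1 hz with rfl | rfl <;> simp)]
  simp [unorderedPairFormula, h.realize_mem, realize_eq, h.injective.eq_iff]

theorem realize_pair (h : IsTransitiveModel ι) (i a b : Fin n) :
    (pairFormula i a b).Realize v xs ↔ ι (xs i) = ZFSet.pair (ι (xs a)) (ι (xs b)) := by
  simp only [pairFormula, BoundedFormula.realize_inf, BoundedFormula.realize_ex,
    BoundedFormula.realize_all, BoundedFormula.realize_imp, BoundedFormula.realize_sup,
    h.realize_mem, h.realize_unorderedPair, Fin.snoc_last, Fin.snoc_castSucc]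
  rw [h.exists_mem_iff (xs i) (fun z => z = {ι (xs a), ι (xs a)}),
    h.exists_mem_iff (xs i) (fun z => z = {ι (xs a), ι (xs b)}),
    h.forall_mem_iff (xs i) (fun z => z = {ι (xs a), ι (xs a)} ∨ z = {ι (xs a), ι (xs b)})]
  simp only [exists_eq_right, ZFSet.pair_eq_singleton, ZFSet.pair]
  rw [ZFSet.ext_iff]
  simp only [ZFSet.mem_pair]
  constructor
  · rintro ⟨h₁, h₂, h₃⟩ z
    exact ⟨h₃ z, by rintro (rfl | rfl) <;> simpa using by assumption⟩
  · intro H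
    exact ⟨(H _).2 (Or.inl rfl), (H _).2 (Or.inr rfl), fun z hz => (H z).1 hz⟩

theorem realize_pairMem (h : IsTransitiveModel ι) (a b i : Fin n) :
    (pairMemFormula a b i).Realize v xs ↔ ZFSet.pair (ι (xs a)) (ι (xs b)) ∈ ι (xs i) := by
  simp only [pairMemFormula, BoundedFormula.realize_inf, BoundedFormula.realize_ex,
    h.realize_mem, h.realize_pair, Fin.snoc_last, Fin.snoc_castSucc]
  rw [h.exists_mem_iff (xs i) (fun z => z = ZFSet.pair (ι (xs a)) (ι (xs b)))]
  simp

theorem realize_subset (h : IsTransitiveModel ι) (i k : Fin n) :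
    (subsetFormula i k).Realize v xs ↔ ι (xs i) ⊆ ι (xs k) := by
  simp only [subsetFormula, BoundedFormula.realize_all, BoundedFormula.realize_imp,
    h.realize_mem, Fin.snoc_last, Fin.snoc_castSucc]
  exact h.forall_mem_iff (xs i) (· ∈ ι (xs k))

theorem realize_transitive (h : IsTransitiveModel ι) (i : Fin n) :
    (transitiveFormula i).Realize v xs ↔ (ι (xs i)).IsTransitive := by
  simp only [transitiveFormula, BoundedFormula.realize_all, BoundedFormula.realize_imp,
    h.realize_mem, h.realize_subset, Fin.snoc_last, Fin.snoc_castSucc]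
  exact h.forall_mem_iff (xs i) (· ⊆ ι (xs i))

theorem realize_ordinal (h : IsTransitiveModel ι) (i : Fin n) :
    (ordinalFormula i).Realize v xs ↔ (ι (xs i)).IsOrdinal := by
  simp only [ordinalFormula, BoundedFormula.realize_all, BoundedFormula.realize_imp,
    BoundedFormula.realize_inf, h.realize_mem, h.realize_transitive, Fin.snoc_last,
    Fin.snoc_castSucc, ZFSet.isOrdinal_iff_forall_mem_isTransitive]
  rw [h.forall_mem_iff (xs i) ZFSet.IsTransitive]

theorem realize_subsetProd (h : IsTransitiveModel ι) (f a b : Fin n) :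
    (subsetProdFormula f a b).Realize v xs ↔ ι (xs f) ⊆ ZFSet.prod (ι (xs a)) (ι (xs b)) := by
  simp only [subsetProdFormula, BoundedFormula.realize_all, BoundedFormula.realize_imp,
    BoundedFormula.realize_inf, BoundedFormula.realize_ex, h.realize_mem, h.realize_pair,
    Fin.snoc_last, Fin.snoc_castSucc]
  refine Iff.trans ?_ (h.forall_mem_iff (xs f) (· ∈ ZFSet.prod (ι (xs a)) (ι (xs b))))
  refine forall₂_congr fun p _ => ?_
  rw [ZFSet.mem_prod, ← h.exists_mem_iff (xs a) (fun z => ∃ w ∈ ι (xs b), ι p = ZFSet.pair z w)]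
  exact exists_congr fun z => and_congr_right fun _ =>
    h.exists_mem_iff (xs b) (fun w => ι p = ZFSet.pair (ι z) w)

theorem realize_uniqueRight (h : IsTransitiveModel ι) (f a : Fin n) :
    (uniqueRightFormula f a).Realize v xs ↔
      ∀ z ∈ ι (xs a), ∃! w, ZFSet.pair z w ∈ ι (xs f) := by
  simp only [uniqueRightFormula, BoundedFormula.realize_all, BoundedFormula.realize_imp,
    BoundedFormula.realize_inf, BoundedFormula.realize_ex, h.realize_mem, h.realize_pairMem,
    realize_eq, Fin.snoc_last, Fin.snoc_castSucc]
  rw [← h.forall_mem_iff (xs a) (fun z => ∃! w, ZFSet.pair z w ∈ ι (xs f))]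
  refine forall₂_congr fun z _ => ⟨?_, ?_⟩
  · rintro ⟨w, hw, H⟩
    refine ⟨ι w, hw, fun y hy => ?_⟩
    obtain ⟨y, rfl⟩ := (h.exists_of_pair_mem hy).2
    rw [H y hy]
  · rintro ⟨w, hw, H⟩
    obtain ⟨w, rfl⟩ := (h.exists_of_pair_mem hw).2
    exact ⟨w, hw, fun y hy => h.injective (H _ hy)⟩

theorem realize_uniqueLeft (h : IsTransitiveModel ι) (f b : Fin n) :
    (uniqueLeftFormula f b).Realize v xs ↔
      ∀ w ∈ ι (xs b), ∃! z, ZFSet.pair z w ∈ ι (xs f) := by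
  simp only [uniqueLeftFormula, BoundedFormula.realize_all, BoundedFormula.realize_imp,
    BoundedFormula.realize_inf, BoundedFormula.realize_ex, h.realize_mem, h.realize_pairMem,
    realize_eq, Fin.snoc_last, Fin.snoc_castSucc]
  rw [← h.forall_mem_iff (xs b) (fun w => ∃! z, ZFSet.pair z w ∈ ι (xs f))]
  refine forall₂_congr fun w _ => ⟨?_, ?_⟩
  · rintro ⟨z, hz, H⟩
    refine ⟨ι z, hz, fun y hy => ?_⟩
    obtain ⟨y, rfl⟩ := (h.exists_of_pair_mem hy).1
    rw [H y hy]
  · rintro ⟨z, hz, H⟩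
    obtain ⟨z, rfl⟩ := (h.exists_of_pair_mem hz).1
    exact ⟨z, hz, fun y hy => h.injective (H _ hy)⟩

theorem realize_bijection (h : IsTransitiveModel ι) (f a b : Fin n) :
    (bijectionFormula f a b).Realize v xs ↔ IsBijection (ι (xs f)) (ι (xs a)) (ι (xs b)) := by
  simp only [bijectionFormula, BoundedFormula.realize_inf, h.realize_subsetProd,
    h.realize_uniqueRight, h.realize_uniqueLeft, IsBijection, ZFSet.IsFunc]

theorem models_numeration_iff (h : IsTransitiveModel ι) :
    S ⊨ numerationSentence ↔
      ∀ a : S, ∃ f b : S, (ι b).IsOrdinal ∧ IsBijection (ι f) (ι a) (ι b) := by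
  simp [numerationSentence, Sentence.Realize, Formula.Realize, h.realize_ordinal,
    h.realize_bijection, Fin.snoc]

theorem models_powerset_iff (h : IsTransitiveModel ι) :
    S ⊨ powersetSentence ↔ ∀ x : S, ∃ y : S, ∀ z : S, ι z ∈ ι y ↔ ι z ⊆ ι x := by
  simp [powersetSentence, Sentence.Realize, Formula.Realize, h.realize_mem, h.realize_subset,
    Fin.snoc]

theorem models_imageInter_iff (h : IsTransitiveModel ι) :
    S ⊨ imageInterSentence ↔ ∀ f x y : S, ∃ z : S, ∀ b : S, ι b ∈ ι z ↔
      ∃ a : S, ι a ∈ ι x ∧ ι a ∈ ι y ∧ ZFSet.pair (ι a) (ι b) ∈ ι f := by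
  simp [imageInterSentence, Sentence.Realize, Formula.Realize, h.realize_mem, h.realize_pairMem,
    Fin.snoc]

end IsTransitiveModel

/-! ### Truth in the universe of sets -/

theorem exists_isBijection_ordinal (a : ZFSet.{u}) :
    ∃ (f : ZFSet.{u}) (o : Ordinal.{u}), IsBijection f a o.toZFSet := by
  have hcard : Cardinal.mk a = Cardinal.mk (a.card.ord.toZFSet) := by
    simp [ZFSet.cardinalMk_coe_sort]
  obtain ⟨e⟩ := Cardinal.eq.1 hcard
  have hmem : ∀ z w, ZFSet.pair z w ∈ ZFSet.range (fun z : a => ZFSet.pair z (e z)) ↔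
      ∃ hz : z ∈ a, (e ⟨z, hz⟩ : ZFSet.{u}) = w := by
    intro z w
    simp only [ZFSet.mem_range, ZFSet.pair_inj, Subtype.exists]
    constructor
    · rintro ⟨z, hz, rfl, h⟩
      exact ⟨hz, h⟩
    · rintro ⟨hz, h⟩
      exact ⟨z, hz, rfl, h⟩
  refine ⟨ZFSet.range (fun z : a => ZFSet.pair z (e z)), a.card.ord, ⟨?_, fun z hz => ?_⟩,
    fun w hw => ?_⟩
  · intro p hp
    obtain ⟨z, rfl⟩ := ZFSet.mem_range.1 hp
    exact ZFSet.pair_mem_prod.2 ⟨z.2, (e z).2⟩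
  · refine ⟨e ⟨z, hz⟩, (hmem _ _).2 ⟨hz, rfl⟩, fun w hw => ?_⟩
    obtain ⟨_, rfl⟩ := (hmem _ _).1 hw
    rfl
  · refine ⟨e.symm ⟨w, hw⟩, (hmem _ _).2 ⟨(e.symm ⟨w, hw⟩).2, by simp⟩, fun z hz => ?_⟩
    obtain ⟨hz, rfl⟩ := (hmem _ _).1 hz
    simp

theorem models_numeration : ZFSet.{u} ⊨ numerationSentence :=
  isTransitiveModel_id.models_numeration_iff.2 fun a =>
    let ⟨f, o, hf⟩ := exists_isBijection_ordinal a
    ⟨f, o.toZFSet, ZFSet.isOrdinal_toZFSet o, hf⟩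

theorem models_powerset : ZFSet.{u} ⊨ powersetSentence :=
  isTransitiveModel_id.models_powerset_iff.2 fun x => ⟨x.powerset, fun _ => ZFSet.mem_powerset⟩

theorem models_imageInter : ZFSet.{u} ⊨ imageInterSentence :=
  isTransitiveModel_id.models_imageInter_iff.2 fun f x y => by
    -- The double union of `f` bounds the image, because `b ∈ {a, b} ∈ (a, b) ∈ f`.
    refine ⟨ZFSet.sep (fun b => ∃ a, a ∈ x ∧ a ∈ y ∧ ZFSet.pair a b ∈ f)
      (ZFSet.sUnion (ZFSet.sUnion f)), fun b => ?_⟩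
    simp only [id, ZFSet.mem_sep, and_iff_right_iff_imp]
    rintro ⟨a, -, -, hab⟩
    exact ZFSet.mem_sUnion_of_mem (y := b) (z := {a, b}) (by simp)
      (ZFSet.mem_sUnion_of_mem (z := ZFSet.pair a b) (by simp [ZFSet.pair]) hab)

/-! ### Cardinality -/

theorem card_le_of_relation {x y : ZFSet.{u}} (R : ZFSet.{u} → ZFSet.{u} → Prop)
    (h : ∀ z ∈ x, ∃ w ∈ y, R z w)
    (hinj : ∀ z ∈ x, ∀ z' ∈ x, ∀ w, R z w → R z' w → z = z') : x.card ≤ y.card := by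
  choose F hF hR using h
  -- `ZFSet.card` lives in universe `u`, the type of elements of a set in `u + 1`.
  rw [← Cardinal.lift_le.{u + 1}, ← ZFSet.cardinalMk_coe_sort, ← ZFSet.cardinalMk_coe_sort]
  refine Cardinal.mk_le_of_injective (f := fun z : x => (⟨F z z.2, hF z z.2⟩ : y)) ?_
  intro z z' e
  refine Subtype.ext (hinj z z.2 z' z'.2 _ (hR z z.2) ?_)
  rw [show F z z.2 = F z' z'.2 from congrArg Subtype.val e]
  exact hR z' z'.2

namespace IsBijection

variable {f x y a a' b : ZFSet.{u}}

theorem left_unique (h : IsBijection f x y) (ha : ZFSet.pair a b ∈ f)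
    (ha' : ZFSet.pair a' b ∈ f) : a = a' :=
  (h.2 b (ZFSet.pair_mem_prod.1 (h.1.1 ha)).2).unique ha ha'

theorem right_mem (h : IsBijection f x y) (ha : ZFSet.pair a b ∈ f) : b ∈ y :=
  (ZFSet.pair_mem_prod.1 (h.1.1 ha)).2

theorem exists_pair_mem (h : IsBijection f x y) (ha : a ∈ x) : ∃ b ∈ y, ZFSet.pair a b ∈ f :=
  let ⟨b, hb, _⟩ := h.1.2 a ha
  ⟨b, h.right_mem hb, hb⟩

theorem card_le (h : IsBijection f x y) : x.card ≤ y.card :=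
  card_le_of_relation (fun z w => ZFSet.pair z w ∈ f) (fun _ hz => h.exists_pair_mem hz)
    fun _ _ _ _ _ hz hz' => h.left_unique hz hz'

end IsBijection

/-! ### Elementary embeddings of the universe -/

section Elementary

variable {M : Set ZFSet.{u}}

theorem coe_mem_coe_iff (j : ZFSet.{u} ↪ₑ[setLang] M) (x y : ZFSet.{u}) :
    (j x : ZFSet.{u}) ∈ (j y : ZFSet.{u}) ↔ x ∈ y :=
  j.map_rel (r := (MemRel.mem : setLang.Relations 2)) ![x, y]

theorem exists_isCardIn (hM : IsTransitiveClass M) (j : ZFSet.{u} ↪ₑ[setLang] M) {a : ZFSet.{u}}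
    (ha : a ∈ M) : ∃ o : Ordinal.{u}, o.toZFSet ∈ M ∧ IsCardIn M a o := by
  obtain ⟨f, b, hb, hf⟩ := hM.isTransitiveModel.models_numeration_iff.1
    ((j.map_sentence _).1 models_numeration) ⟨a, ha⟩
  -- What `M` takes for an ordinal is a true one, hence the von Neumann ordinal of its rank.
  rw [← hb.toZFSet_rank_eq] at hf
  have hne : {β : Ordinal.{u} | ∃ f ∈ M, IsBijection f a β.toZFSet}.Nonempty :=
    ⟨_, f, f.2, hf⟩
  have hle : sInf {β : Ordinal.{u} | ∃ f ∈ M, IsBijection f a β.toZFSet} ≤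
      (b : ZFSet.{u}).rank := csInf_le' ⟨f, f.2, hf⟩
  refine ⟨_, ?_, ha, csInf_mem hne, fun β hβ => csInf_le' hβ⟩
  -- The least ordinal is at most one lying in the transitive class `M`, so it lies in `M` too.
  rcases hle.eq_or_lt with h | h
  · rw [h, hb.toZFSet_rank_eq]
    exact b.2
  · refine hM b b.2 _ ?_
    rw [← hb.toZFSet_rank_eq]
    exact Ordinal.toZFSet_mem_toZFSet_iff.2 h

theorem IsCardIn.toZFSet_mem (hM : IsTransitiveClass M) (j : ZFSet.{u} ↪ₑ[setLang] M)
    {a : ZFSet.{u}} {θ : Ordinal.{u}} (h : IsCardIn M a θ) : θ.toZFSet ∈ M := by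
  obtain ⟨o, ho, hao⟩ := exists_isCardIn hM j h.1
  rwa [h.2.unique hao.2]

theorem powersetIn_mem (hM : IsTransitiveClass M) (j : ZFSet.{u} ↪ₑ[setLang] M) {x : ZFSet.{u}}
    (hx : x ∈ M) : powersetIn M x ∈ M := by
  obtain ⟨y, hy⟩ := hM.isTransitiveModel.models_powerset_iff.1
    ((j.map_sentence _).1 models_powerset) ⟨x, hx⟩
  -- By transitivity, the power set in the sense of `M` is exactly `P(x) ∩ M`.
  convert y.2
  ext z
  simp only [powersetIn, ZFSet.mem_sep, ZFSet.mem_powerset]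
  exact ⟨fun h => (hy ⟨z, h.2⟩).2 h.1, fun h => ⟨(hy ⟨z, hM y y.2 z h⟩).1 h, hM y y.2 z h⟩⟩

theorem exists_image_inter_mem (hM : IsTransitiveClass M) (j : ZFSet.{u} ↪ₑ[setLang] M)
    {f x y : ZFSet.{u}} (hf : f ∈ M) (hx : x ∈ M) (hy : y ∈ M) :
    ∃ z ∈ M, ∀ b, b ∈ z ↔ ∃ a, a ∈ x ∧ a ∈ y ∧ ZFSet.pair a b ∈ f := by
  have h := hM.isTransitiveModel
  obtain ⟨z, hz⟩ := h.models_imageInter_iff.1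
    ((j.map_sentence _).1 models_imageInter) ⟨f, hf⟩ ⟨x, hx⟩ ⟨y, hy⟩
  refine ⟨z, z.2, fun b => ⟨fun hb => ?_, ?_⟩⟩
  · obtain ⟨a, ha⟩ := (hz ⟨b, hM z z.2 b hb⟩).1 hb
    exact ⟨a, ha⟩
  · rintro ⟨a, hax, hay, hab⟩
    obtain ⟨b, rfl⟩ := (h.exists_of_pair_mem (f := ⟨f, hf⟩) hab).2
    exact (hz b).2 ⟨⟨a, hM x hx a hax⟩, hax, hay, hab⟩

theorem two_power_le_card_powersetIn (hM : IsTransitiveClass M) (j : ZFSet.{u} ↪ₑ[setLang] M)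
    {r A f t : ZFSet.{u}} (hA : A ∈ M) (hrA : ∀ x ∈ r, (j x : ZFSet.{u}) ∈ A) (hf : f ∈ M)
    (hfA : IsBijection f A t) : (2 : Cardinal.{u}) ^ r.card ≤ (powersetIn M t).card := by
  rw [← ZFSet.card_powerset]
  -- The relation says `Z = f[A ∩ j(X)]`.
  refine card_le_of_relation (fun X Z => ∀ b, b ∈ Z ↔ ∃ a, a ∈ A ∧ a ∈ (j X : ZFSet.{u}) ∧
    ZFSet.pair a b ∈ f) (fun X _ => ?_) ?_
  · obtain ⟨Z, hZM, hZ⟩ := exists_image_inter_mem hM j hf hA (j X).2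
    refine ⟨Z, ?_, hZ⟩
    rw [powersetIn, ZFSet.mem_sep, ZFSet.mem_powerset]
    refine ⟨fun b hb => ?_, hZM⟩
    obtain ⟨a, -, -, hab⟩ := (hZ b).1 hb
    exact hfA.right_mem hab
  · have key : ∀ X ∈ r.powerset, ∀ X' Z : ZFSet.{u},
        (∀ b, b ∈ Z ↔ ∃ a, a ∈ A ∧ a ∈ (j X : ZFSet.{u}) ∧ ZFSet.pair a b ∈ f) →
        (∀ b, b ∈ Z ↔ ∃ a, a ∈ A ∧ a ∈ (j X' : ZFSet.{u}) ∧ ZFSet.pair a b ∈ f) → X ⊆ X' := by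
      intro X hX X' Z hZ hZ' x hx
      have hxA := hrA x (ZFSet.mem_powerset.1 hX hx)
      obtain ⟨b, -, hb⟩ := hfA.exists_pair_mem hxA
      -- The point `b = f(j(x))` lies in the common image `Z`, so it also comes from some `a ∈
      -- j(X')`; injectivity of `f` forces `a = j(x)`.
      obtain ⟨a, -, ha, hab⟩ := (hZ' b).1 ((hZ b).2 ⟨_, hxA, (coe_mem_coe_iff j _ _).2 hx, hb⟩)
      rw [hfA.left_unique hab hb] at ha
      exact (coe_mem_coe_iff j _ _).1 ha
    exact fun X hX X' hX' Z hZ hZ' =>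
      subset_antisymm (key X hX X' Z hZ hZ') (key X' hX' X Z hZ' hZ)

theorem exists_isTightness (hM : IsTransitiveClass M) (j : ZFSet.{u} ↪ₑ[setLang] M)
    (ρ : Cardinal.{u}) : ∃ θ : Ordinal.{u}, IsTightness j ρ θ := by
  obtain ⟨o, -, ho⟩ := exists_isCardIn hM j (j ρ.ord.toZFSet).2
  have hne : {α : Ordinal.{u} | ∃ A : ZFSet.{u},
      (∀ x ∈ ρ.ord.toZFSet, (j x : ZFSet.{u}) ∈ A) ∧ IsCardIn M A α}.Nonempty :=
    -- The set `j(ρ)` is itself a cover in `M`.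
    ⟨o, _, fun x hx => (coe_mem_coe_iff j _ _).2 hx, ho⟩
  exact ⟨_, csInf_mem hne, fun β hβ => csInf_le' hβ⟩

end Elementary

end SetTheoryModel

open FirstOrder SetTheoryModel
theorem mainTheorem7 (M : Set ZFSet.{u}) (hM : IsTransitiveClass M)
    (j : ZFSet.{u} ↪ₑ[setLang] M) (ρ : Cardinal.{u}) :
    (∃ θ : Ordinal.{u}, IsTightness j ρ θ) ∧
      ∀ θ : Ordinal.{u}, IsTightness j ρ θ →
        ∃ τ : Ordinal.{u}, IsTwoPowIn M θ τ ∧ ((2 : Cardinal.{u}) ^ ρ).ord ≤ τ := by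
  refine ⟨exists_isTightness hM j ρ, fun θ hθ => ?_⟩
  obtain ⟨A, hρA, hA⟩ := hθ.1
  obtain ⟨τ, -, hτ⟩ := exists_isCardIn hM j (powersetIn_mem hM j (hA.toZFSet_mem hM j))
  refine ⟨τ, hτ, ?_⟩
  obtain ⟨f, hf, hfA⟩ := hA.2.1
  obtain ⟨g, -, hg⟩ := hτ.2.1
  -- It suffices to compare cardinalities in `V`, where `g` is still a bijection.
  rw [Cardinal.ord_le]
  simpa using (two_power_le_card_powersetIn hM j hA.1 hρA hf hfA).trans hg.card_le
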